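/- \textbf{Theorem (Hilbert's Nullstellensatz for skew PBW extensions).} \emph{Setting.} Let $\mathbb F$ be an algebraically closed field and let $A\supseteq\mathbb F$ be a ring (associative with $1$; $\mathbb F$ need not be central in $A$). Let $x_1,\dots,x_n\in A$ be such that $A=\sigma(\mathbb F)\langle x_1,\dots,x_n\rangle$ is a skew PBW extension of $\mathbb F$, that is: $A$ is a free left $\mathbb F$-module with basis the standard monomials $x_1^{\alpha_1}\cdots x_n^{\alpha_n}$, $\alpha\in\mathbb N^n$; for every $i$ and every $r\in\mathbb F\setminus\{0\}$ there is $c_{i,r}\in\mathbb F\setminus\{0\}$ with $x_ir-c_{i,r}x_i\in\mathbb F$; and for all $i,j$ there is $c_{i,j}\in\mathbb F\setminus\{0\}$ with $x_jx_i-c_{i,j}x_ix_j\in\mathbb F+\mathbb Fx_1+\cdots+\mathbb Fx_n$. Assume that $A$ is quasi-commutative (for every $i$ and every $r\neq0$ there is $c_{i,r}\ne0$ with $x_ir=c_{i,r}x_i$, and for all $i,j$ there is $c_{i,j}\neq0$ with $x_jx_i=c_{i,j}x_ix_j$) and bijective (the maps $\sigma_i:\mathbb F\to\mathbb F$ determined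 by $x_ir-\sigma_i(r)x_i\in\mathbb F$ are bijective and the $c_{i,j}$ are invertible). Assume that the center $Z(A)$ is a polynomial ring in $n$ variables with coefficients in $\mathbb F$: there are a ring homomorphism $\kappa:\mathbb F\to Z(A)$ (for instance the inclusion, when $\mathbb F\subseteq Z(A)$) and elements $y_1,\dots,y_n\in Z(A)$ such that the ring homomorphism $\mathbb F[t_1,\dots,t_n]\to Z(A)$ that is $\kappa$ on $\mathbb F$ and sends $t_i\mapsto y_i$ is an isomorphism. \emph{Notation.} For $Z=(z_1,\dots,z_n)\in\mathbb F^n$ let $\langle Z\rangle$ be the two-sided ideal of $A$ generated by $x_1-z_1,\dots,x_n-z_n$, and for $f\in A$ write $f(Z)=0$ if $f\in\langle Z\rangle$. For $S\subseteq A$ put $V(S)=\{Z\in\mathbb F^n\mid f(Z)=0\text{ for all }f\in S\}$, and for $X\subseteq\mathbb F^n$ put $I(X)=\{g\in A\mid g(Z)=0\text{ for all }Z\in X\}$, a two-sided ideal of $A$. Define $V_{Z(A)}$ and $I_{Z(A)}$ in the same way with $Z(A)$, $\kappa$, $y_1,\dots,y_n$ in place of $A$, the inclusion $\mathbb F\subseteq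 A$, $x_1,\dots,x_n$; so the roots of $f\in Z(A)$ are the $Z\in\mathbb F^n$ for which $f$ lies in the ideal of $Z(A)$ generated by $y_1-\kappa(z_1),\dots,y_n-\kappa(z_n)$. A two-sided ideal $P\neq A$ is prime if for all left ideals $L,L'$ of $A$ one has $LL'\subseteq P$ if and only if $L\subseteq P$ or $L'\subseteq P$; $\sqrt I$ denotes the intersection of all prime ideals of $A$ containing $I$ (equal to $A$ if there are none). \emph{Conclusion.} For every two-sided ideal $I$ of $A$, with $J=I\cap Z(A)$, $$\langle I_{Z(A)}(V_{Z(A)}(J))\rangle\subseteq\sqrt I\subseteq I(V(I)),$$ where $\langle\,\cdot\,\rangle$ on the left is the two-sided ideal of $A$ generated by the given subset of $Z(A)\subseteq A$. -/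

import Mathlib

namespace SkewPBW

/-- The standard monomial `x₁^α₁ ⋯ xₙ^αₙ` (factors in this order). -/
def stdMonomial {A : Type*} [Ring A] {n : ℕ} (x : Fin n → A) (α : Fin n → ℕ) : A :=
  (List.ofFn fun i => x i ^ α i).prod

/-- `A` is a skew PBW extension of `R` in the elements `x₁, …, xₙ`; the inclusion of `R` in `A` is
the injective ring homomorphism `ι`, and the left `R`-module structure of `A` is `(r, a) ↦ ι r * a`.
-/
structure IsSkewPBW {R A : Type*} [Ring R] [Ring A] {n : ℕ} (ι : R →+* A) (x : Fin n → A) :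
    Prop where
  injective : Function.Injective ι
  /-- `A` is a free left `R`-module with basis the standard monomials. -/
  basis : ∀ f : A, ∃! c : (Fin n → ℕ) →₀ R, f = c.sum fun α r => ι r * stdMonomial x α
  var_coeff : ∀ (i : Fin n) (r : R), r ≠ 0 →
    ∃ c : R, c ≠ 0 ∧ ∃ d : R, x i * ι r - ι c * x i = ι d
  var_var : ∀ i j : Fin n, ∃ c : R, c ≠ 0 ∧ ∃ (d : R) (a : Fin n → R),
    x j * x i - ι c * x i * x j = ι d + ∑ k, ι (a k) * x k

/-- Quasi-commutativity of a skew PBW extension. -/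
structure IsQuasiCommutative {R A : Type*} [Ring R] [Ring A] {n : ℕ} (ι : R →+* A)
    (x : Fin n → A) : Prop where
  var_coeff : ∀ (i : Fin n) (r : R), r ≠ 0 → ∃ c : R, c ≠ 0 ∧ x i * ι r = ι c * x i
  var_var : ∀ i j : Fin n, ∃ c : R, c ≠ 0 ∧ x j * x i = ι c * x i * x j

/-- Bijectivity of a skew PBW extension: the maps `σᵢ` with `xᵢ r - σᵢ(r) xᵢ ∈ R` (they are
uniquely determined, by freeness over the standard monomials) are bijective, and the coefficients
`cᵢⱼ` with `xⱼ xᵢ - cᵢⱼ xᵢ xⱼ ∈ R + R x₁ + ⋯ + R xₙ` are invertible. -/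
structure IsBijective {R A : Type*} [Ring R] [Ring A] {n : ℕ} (ι : R →+* A)
    (x : Fin n → A) : Prop where
  sigma_bijective : ∀ i : Fin n, ∃ σ : R → R, Function.Bijective σ ∧
    ∀ r : R, ∃ d : R, x i * ι r - ι (σ r) * x i = ι d
  coeff_isUnit : ∀ i j : Fin n, ∃ c : R, IsUnit c ∧ ∃ (d : R) (a : Fin n → R),
    x j * x i - ι c * x i * x j = ι d + ∑ k, ι (a k) * x k

/-- `S` is a polynomial ring in the (commuting) variables `y₁, …, yₙ` with coefficients in `F`,
where `F` maps to `S` by `κ`: the homomorphism `F[t₁, …, tₙ] → S` that is `κ` on `F` and sends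
`tᵢ` to `yᵢ` is an isomorphism. -/
def IsPolynomialRing {F S : Type*} [CommRing F] [CommRing S] {n : ℕ} (κ : F →+* S)
    (y : Fin n → S) : Prop :=
  Function.Bijective (MvPolynomial.eval₂Hom κ y)

/-- The two-sided ideal `⟨Z⟩ = ⟨x₁ - z₁, …, xₙ - zₙ⟩`. -/
def pointIdeal {R A : Type*} [Ring R] [Ring A] {n : ℕ} (ι : R →+* A) (x : Fin n → A)
    (Z : Fin n → R) : TwoSidedIdeal A :=
  TwoSidedIdeal.span (Set.range fun i => x i - ι (Z i))

/-- `Z` is a root of `f`, in symbols `f(Z) = 0`. -/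
def IsRoot {R A : Type*} [Ring R] [Ring A] {n : ℕ} (ι : R →+* A) (x : Fin n → A)
    (f : A) (Z : Fin n → R) : Prop :=
  f ∈ pointIdeal ι x Z

/-- The vanishing set `V(S)`. -/
def vanishingSet {R A : Type*} [Ring R] [Ring A] {n : ℕ} (ι : R →+* A) (x : Fin n → A)
    (S : Set A) : Set (Fin n → R) :=
  {Z | ∀ f ∈ S, IsRoot ι x f Z}

/-- The ideal of points `I(X) = {g ∈ A | g(Z) = 0 for every Z ∈ X}`. -/
def idealOfPoints {R A : Type*} [Ring R] [Ring A] {n : ℕ} (ι : R →+* A) (x : Fin n → A)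
    (X : Set (Fin n → R)) : TwoSidedIdeal A :=
  TwoSidedIdeal.mk' {g | ∀ Z ∈ X, IsRoot ι x g Z}
    (fun Z _ => (pointIdeal ι x Z).zero_mem)
    (fun hf hg Z hZ => (pointIdeal ι x Z).add_mem (hf Z hZ) (hg Z hZ))
    (fun hf Z hZ => (pointIdeal ι x Z).neg_mem (hf Z hZ))
    (fun hf Z hZ => (pointIdeal ι x Z).mul_mem_left _ _ (hf Z hZ))
    (fun hf Z hZ => (pointIdeal ι x Z).mul_mem_right _ _ (hf Z hZ))

/-- A two-sided ideal `P ≠ S` is prime if, for all left ideals `L`, `J` of `S`, `L J ⊆ P` if and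
only if `L ⊆ P` or `J ⊆ P`. -/
structure IsPrimeIdeal {S : Type*} [Ring S] (P : TwoSidedIdeal S) : Prop where
  ne_top : P ≠ ⊤
  mul_le_iff : ∀ L J : Ideal S,
    L * J ≤ TwoSidedIdeal.asIdeal P ↔ L ≤ TwoSidedIdeal.asIdeal P ∨ J ≤ TwoSidedIdeal.asIdeal P

/-- The (prime) radical `√I`: the intersection of all prime ideals containing `I`, which is the
whole ring if there are none. -/
def radical {S : Type*} [Ring S] (I : TwoSidedIdeal S) : TwoSidedIdeal S :=
  sInf {P | IsPrimeIdeal P ∧ I ≤ P}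

end SkewPBW

namespace SkewPBW

variable {R A : Type*} [Ring R] [Ring A] {n : ℕ}

/-! The two inclusions are independent. Right: modulo `⟨Z⟩` each variable becomes a scalar, so `F →
A/⟨Z⟩` is surjective (`IsSkewPBW.exists_mk_eq`). The quotient is therefore zero or a copy of the
field, and `⟨Z⟩` is either `A` or completely prime, hence prime. For `Z ∈ V(I)` it contains `I`, so
in both cases it contains `√I`. Left: since the center is a polynomial ring over an algebraically
closed field, the classical Nullstellensatz puts a power of each `f ∈ I(V(J))` into `J ⊆ I`
(`IsPolynomialRing.exists_pow_mem`). A prime containing `I` contains that power, and, because `f` is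
central, also `f` itself (`IsPrimeIdeal.mem_of_pow_mem`). -/

/-- Modulo `⟨x₁ - z₁, …, xₙ - zₙ⟩` the variable `xᵢ` is the scalar `zᵢ`. -/
theorem mk_pointIdeal_var (ι : R →+* A) (x : Fin n → A) (Z : Fin n → R) (i : Fin n) :
    (pointIdeal ι x Z).ringCon.mk' (x i) = (pointIdeal ι x Z).ringCon.mk' (ι (Z i)) :=
  (RingCon.eq _).2 ((TwoSidedIdeal.rel_iff _ _ _).2 (TwoSidedIdeal.subset_span ⟨i, rfl⟩))

theorem mk_eq_zero_iff (P : TwoSidedIdeal A) (a : A) : P.ringCon.mk' a = 0 ↔ a ∈ P := by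
  rw [← map_zero P.ringCon.mk', TwoSidedIdeal.mem_iff]
  exact RingCon.eq _

/-- Modulo the ideal of a point every element of a skew PBW extension is a scalar. -/
theorem IsSkewPBW.exists_mk_eq {ι : R →+* A} {x : Fin n → A} (hA : IsSkewPBW ι x)
    (Z : Fin n → R) (f : A) :
    ∃ r : R, (pointIdeal ι x Z).ringCon.mk' (ι r) = (pointIdeal ι x Z).ringCon.mk' f := by
  set q := (pointIdeal ι x Z).ringCon.mk'
  -- The elements congruent to a scalar form a subring containing `F` and the variables, hence all
  -- standard monomials and their combinations.
  suffices h : f ∈ ((q.comp ι).range).comap q from h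
  obtain ⟨c, rfl, -⟩ := hA.basis f
  refine sum_mem fun α _ => mul_mem ⟨_, rfl⟩ (list_prod_mem fun a ha => ?_)
  obtain ⟨i, rfl⟩ := List.mem_ofFn.1 ha
  exact pow_mem (show x i ∈ ((q.comp ι).range).comap q from
    ⟨Z i, (mk_pointIdeal_var ι x Z i).symm⟩) _

/-- A proper completely prime ideal is prime. -/
theorem isPrimeIdeal_of_mem_or_mem {P : TwoSidedIdeal A} (hP : P ≠ ⊤)
    (h : ∀ a b, a * b ∈ P → a ∈ P ∨ b ∈ P) : IsPrimeIdeal P where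
  ne_top := hP
  mul_le_iff L J := by
    refine ⟨fun hLJ => ?_, ?_⟩
    · by_contra! hne
      obtain ⟨a, haL, haP⟩ := SetLike.not_le_iff_exists.1 hne.1
      obtain ⟨b, hbJ, hbP⟩ := SetLike.not_le_iff_exists.1 hne.2
      rw [TwoSidedIdeal.mem_asIdeal] at haP hbP
      exact (h a b (TwoSidedIdeal.mem_asIdeal.1 (hLJ (Ideal.mul_mem_mul haL hbJ)))).elim haP hbP
    · rintro (hL | hJ)
      · exact Ideal.mul_le.2 fun a ha b _ => TwoSidedIdeal.mem_asIdeal.2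
          (P.mul_mem_right _ _ (TwoSidedIdeal.mem_asIdeal.1 (hL ha)))
      · exact Ideal.mul_le.2 fun a _ b hb => TwoSidedIdeal.mem_asIdeal.2
          (P.mul_mem_left _ _ (TwoSidedIdeal.mem_asIdeal.1 (hJ hb)))

/-- The ideal of a point is everything or prime, the quotient being a quotient of the field. -/
theorem IsSkewPBW.isPrimeIdeal_pointIdeal {F : Type*} [Field F] {ι : F →+* A} {x : Fin n → A}
    (hA : IsSkewPBW ι x) {Z : Fin n → F} (hZ : pointIdeal ι x Z ≠ ⊤) :
    IsPrimeIdeal (pointIdeal ι x Z) := by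
  refine isPrimeIdeal_of_mem_or_mem hZ fun a b hab => ?_
  rw [← mk_eq_zero_iff, map_mul] at hab
  rw [← mk_eq_zero_iff, ← mk_eq_zero_iff]
  obtain ⟨r, hr⟩ := hA.exists_mk_eq Z a
  rcases eq_or_ne r 0 with rfl | hr0
  · left
    rw [← hr, map_zero, map_zero]
  · right
    set q := (pointIdeal ι x Z).ringCon.mk'
    -- The class of `a` is that of a nonzero scalar, hence invertible, and can be cancelled from `ab
    -- = 0`.
    calc q b = q (ι r⁻¹) * (q (ι r) * q b) := by
          rw [← mul_assoc, ← map_mul q, ← map_mul ι, inv_mul_cancel₀ hr0, map_one, map_one, one_mul]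
      _ = 0 := by rw [hr, hab, mul_zero]

/-- A prime ideal containing a power of a central element contains the element. -/
theorem IsPrimeIdeal.mem_of_pow_mem {P : TwoSidedIdeal A} (hP : IsPrimeIdeal P) {a : A}
    (ha : a ∈ Subring.center A) {m : ℕ} (h : a ^ m ∈ P) : a ∈ P := by
  induction m with
  | zero =>
    rw [pow_zero] at h
    simpa using P.mul_mem_left a 1 h
  | succ m ih =>
    -- Primeness speaks of products of left ideals, here `Aa · Aaᵐ`. Centrality moves `a` past the
    -- coefficient in between, so this product lies in `Aaᵐ⁺¹`.
    have hmul : Ideal.span {a} * Ideal.span {a ^ m} ≤ TwoSidedIdeal.asIdeal P := by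
      refine Ideal.mul_le.2 fun r hr s hs => TwoSidedIdeal.mem_asIdeal.2 ?_
      obtain ⟨r, rfl⟩ := Ideal.mem_span_singleton'.1 hr
      obtain ⟨s, rfl⟩ := Ideal.mem_span_singleton'.1 hs
      have hcomm : r * a * (s * a ^ m) = r * s * a ^ (m + 1) := by
        rw [pow_succ', mul_assoc, ← mul_assoc a, ← Subring.mem_center_iff.1 ha s]
        simp only [mul_assoc]
      rw [hcomm]
      exact P.mul_mem_left _ _ h
    rcases (hP.mul_le_iff _ _).1 hmul with h₁ | h₁
    · exact TwoSidedIdeal.mem_asIdeal.1 (h₁ (Ideal.mem_span_singleton_self a))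
    · exact ih (TwoSidedIdeal.mem_asIdeal.1 (h₁ (Ideal.mem_span_singleton_self _)))

theorem mem_idealOfPoints {ι : R →+* A} {x : Fin n → A} {X : Set (Fin n → R)} {f : A} :
    f ∈ idealOfPoints ι x X ↔ ∀ Z ∈ X, f ∈ pointIdeal ι x Z :=
  TwoSidedIdeal.mem_mk' _ _ _ _ _ _ _

theorem mem_radical {I : TwoSidedIdeal A} {f : A} :
    f ∈ radical I ↔ ∀ P, IsPrimeIdeal P → I ≤ P → f ∈ P := by
  simp [radical, TwoSidedIdeal.mem_sInf]

section PolynomialRing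

variable {F S : Type*} [Field F] [CommRing S] {κ : F →+* S} {y : Fin n → S}

/-- In a polynomial ring, `f(Z) = 0` has its usual meaning. -/
theorem IsPolynomialRing.isRoot_iff (h : IsPolynomialRing κ y) (p : MvPolynomial (Fin n) F)
    (Z : Fin n → F) :
    IsRoot κ y (MvPolynomial.eval₂Hom κ y p) Z ↔ MvPolynomial.eval Z p = 0 := by
  constructor
  · intro hp
    let e : MvPolynomial (Fin n) F ≃+* S := RingEquiv.ofBijective _ h
    -- Evaluation at `Z`, transported to `S` along the isomorphism, kills the generators of the
    -- point ideal and hence the whole ideal.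
    have hle : pointIdeal κ y Z ≤
        TwoSidedIdeal.ker ((MvPolynomial.eval Z).comp e.symm.toRingHom) := by
      refine TwoSidedIdeal.span_le.2 ?_
      rintro _ ⟨i, rfl⟩
      have hy : y i - κ (Z i) = e (MvPolynomial.X i - MvPolynomial.C (Z i)) := by
        change _ = MvPolynomial.eval₂Hom κ y _
        simp
      change y i - κ (Z i) ∈ _
      rw [SetLike.mem_coe, TwoSidedIdeal.mem_ker, hy]
      simp
    have hmem := (TwoSidedIdeal.mem_ker _).1 (hle hp)
    have hs : e.symm (MvPolynomial.eval₂Hom κ y p) = p := e.symm_apply_apply p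
    exact (congrArg (MvPolynomial.eval Z) hs).symm.trans hmem
  · intro hp
    -- Modulo the point ideal, `p` is congruent to the scalar `p(Z)`: both sides are ring
    -- homomorphisms agreeing on constants and variables.
    have hcomp : (pointIdeal κ y Z).ringCon.mk'.comp (MvPolynomial.eval₂Hom κ y) =
        ((pointIdeal κ y Z).ringCon.mk'.comp κ).comp (MvPolynomial.eval Z) := by
      refine MvPolynomial.ringHom_ext (fun r => by simp) fun i => ?_
      simpa using mk_pointIdeal_var κ y Z i
    rw [IsRoot, ← mk_eq_zero_iff, ← RingHom.comp_apply, hcomp, RingHom.comp_apply, hp, map_zero]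

/-- Hilbert's Nullstellensatz in a polynomial ring over an algebraically closed field. -/
theorem IsPolynomialRing.exists_pow_mem [IsAlgClosed F] (h : IsPolynomialRing κ y)
    {J : TwoSidedIdeal S} {f : S} (hf : f ∈ idealOfPoints κ y (vanishingSet κ y (J : Set S))) :
    ∃ m : ℕ, f ^ m ∈ J := by
  obtain ⟨p, rfl⟩ := h.2 f
  -- The ideal `J` is pulled back to `F[t₁, …, tₙ]`; by `isRoot_iff` its ordinary zero locus lies in
  -- the vanishing set of `J`.
  let K : Ideal (MvPolynomial (Fin n) F) :=
    (TwoSidedIdeal.asIdeal J).comap (MvPolynomial.eval₂Hom κ y)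
  have hp : p ∈ MvPolynomial.vanishingIdeal F (MvPolynomial.zeroLocus F K) := by
    intro Z hZ
    have hroot := mem_idealOfPoints.1 hf Z fun g hg => by
      obtain ⟨q, rfl⟩ := h.2 g
      refine (h.isRoot_iff q Z).2 ?_
      simpa using hZ q (TwoSidedIdeal.mem_asIdeal.2 hg)
    simpa using (h.isRoot_iff p Z).1 hroot
  rw [MvPolynomial.vanishingIdeal_zeroLocus_eq_radical] at hp
  obtain ⟨m, hm⟩ := hp
  exact ⟨m, by simpa [K, TwoSidedIdeal.mem_asIdeal] using hm⟩

end PolynomialRing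

end SkewPBW

theorem mainTheorem1 {F : Type*} [Field F] [IsAlgClosed F] {A : Type*} [Ring A] {n : ℕ}
    (ι : F →+* A) (x : Fin n → A)
    (hA : SkewPBW.IsSkewPBW ι x)
    (hqc : SkewPBW.IsQuasiCommutative ι x)
    (hbij : SkewPBW.IsBijective ι x)
    (κ : F →+* Subring.center A) (y : Fin n → Subring.center A)
    (hZ : SkewPBW.IsPolynomialRing κ y)
    (I : TwoSidedIdeal A) (J : TwoSidedIdeal (Subring.center A))
    (hJ : J = TwoSidedIdeal.comap (Subring.center A).subtype I) :
    TwoSidedIdeal.span ((Subring.center A).subtype ''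
        (SkewPBW.idealOfPoints κ y (SkewPBW.vanishingSet κ y (J : Set (Subring.center A))) :
          Set (Subring.center A))) ≤ SkewPBW.radical I ∧
      SkewPBW.radical I ≤ SkewPBW.idealOfPoints ι x (SkewPBW.vanishingSet ι x (I : Set A)) := by
  subst hJ
  constructor
  · refine TwoSidedIdeal.span_le.2 ?_
    rintro _ ⟨f, hf, rfl⟩
    refine SkewPBW.mem_radical.2 fun P hP hIP => ?_
    obtain ⟨m, hm⟩ := hZ.exists_pow_mem hf
    refine hP.mem_of_pow_mem f.2 (m := m) (hIP ?_)
    simpa using (TwoSidedIdeal.mem_comap _).1 hm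
  · intro f hf
    refine SkewPBW.mem_idealOfPoints.2 fun Z hZ => ?_
    -- The point ideal can be all of `A`: quasi-commutativity gives `zᵢ(r - c) ∈ ⟨Z⟩` whenever `xᵢ r
    -- = c xᵢ`, which may be a unit. It is then not prime, but membership is trivial.
    by_cases htop : SkewPBW.pointIdeal ι x Z = ⊤
    · rw [htop]
      trivial
    -- `Z ∈ V(I)` says exactly that `I ≤ ⟨Z⟩`, so `⟨Z⟩` is one of the primes intersected in `√I`.
    · exact SkewPBW.mem_radical.1 hf _ (hA.isPrimeIdeal_pointIdeal htop) fun g hg => hZ g hg
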